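/- Let $d\ge 1$ and let $\eta$ be a homogeneous Poisson process of rate $1$ in $\mathbb{R}^d$, regarded as a random countable set of points. Let $l:(0,\infty)\to[0,\infty)$ be a non-increasing function with $$\int_1^\infty r^{d-1}l(r)\,dr<\infty ,$$ put $l(0):=\lim_{r\downarrow 0}l(r)\in[0,\infty]$, and define the random field $$\Psi(y):=\sum_{x\in\eta}l(|x-y|)\in[0,\infty],\qquad y\in\mathbb{R}^d .$$ (If $l$ is unbounded, i.e. $l(0)=\infty$, then $\Psi(y)=\infty$ at every point $y\in\eta$.) If $l$ is continuous on $(0,\infty)$, then almost surely $\Psi$ is continuous everywhere: almost surely, the function $\Psi:\mathbb{R}^d\to[0,\infty]$ is continuous at every $y\in\mathbb{R}^d$ (for the usual topology of $[0,\infty]$), and for every $y\in\mathbb{R}^d$ one has $\Psi(y)=\infty$ if and only if $l(0)=\infty$ and $y\in\eta$. In particular, if $l$ is bounded, $\Psi$ is almost surely a finite, real-valued continuous function on $\mathbb{R}^d$. -/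

import Mathlib

open MeasureTheory ProbabilityTheory Filter Topology
open scoped ENNReal NNReal

/-- The space `ℝ^d` with its Euclidean norm. -/
abbrev EucSpace (d : ℕ) : Type := EuclideanSpace ℝ (Fin d)

/-- `η` is a homogeneous Poisson (point) process of rate `rate` in `ℝ^d` on the probability space
`(Ω, P)`, regarded as a random countable subset of `ℝ^d`: the number of points in a Borel set is
a random variable (with values in `ℕ ∪ {∞}`), the numbers of points in disjoint Borel sets are
independent, and the number of points in a Borel set of finite volume has the Poisson distribution
with parameter `rate` times the volume. -/
structure IsPoissonProcess {Ω : Type*} [MeasurableSpace Ω] (P : Measure Ω) {d : ℕ}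
    (rate : ℝ≥0) (η : Ω → Set (EucSpace d)) : Prop where
  countable : ∀ ω, (η ω).Countable
  measurable_count : ∀ B : Set (EucSpace d), MeasurableSet B →
    Measurable fun ω => (η ω ∩ B).encard
  indep_count : ∀ (n : ℕ) (B : Fin n → Set (EucSpace d)), (∀ i, MeasurableSet (B i)) →
    (Pairwise fun i j => Disjoint (B i) (B j)) →
    iIndepFun (fun i ω => (η ω ∩ B i).encard) P
  law_count : ∀ B : Set (EucSpace d), MeasurableSet B → volume B ≠ ∞ →
    HasLaw (fun ω => (η ω ∩ B).encard)
      ((poissonMeasure (rate * (volume B).toNNReal)).map (fun k : ℕ => (k : ℕ∞))) P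

/-- An attenuation function: a non-increasing function `l : (0,∞) → [0,∞)`. Only the values at
positive reals matter. -/
structure IsAttenuation (l : ℝ → ℝ) : Prop where
  nonneg : ∀ r, 0 < r → 0 ≤ l r
  antitone : AntitoneOn l (Set.Ioi 0)

/-- The value `l(0) = lim_{r → 0+} l(r)`, in `[0,∞]`. -/
noncomputable def attenuationZero (l : ℝ → ℝ) : ℝ≥0∞ :=
  limUnder (𝓝[>] (0 : ℝ)) fun r => ENNReal.ofReal (l r)

/-- The limit defining `l(0)` exists for every attenuation function. -/
theorem tendsto_attenuationZero {l : ℝ → ℝ} (hl : IsAttenuation l) :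
    Tendsto (fun r => ENNReal.ofReal (l r)) (𝓝[>] (0 : ℝ)) (𝓝 (attenuationZero l)) := by
  have h : AntitoneOn (fun r => ENNReal.ofReal (l r)) (Set.Ioi 0) :=
    fun a ha b hb hab => ENNReal.ofReal_le_ofReal (hl.antitone ha hb hab)
  exact tendsto_nhds_limUnder ⟨_, h.tendsto_nhdsGT (OrderTop.bddAbove _)⟩

open Classical in
/-- The attenuation function extended to `[0,∞)` by `l(0) = lim_{r → 0+} l(r)`, as a function with
values in `[0,∞]`. -/
noncomputable def attenuationExt (l : ℝ → ℝ) (r : ℝ) : ℝ≥0∞ :=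
  if r = 0 then attenuationZero l else ENNReal.ofReal (l r)

/-- The field `Ψ(y) = ∑_{x ∈ S} l(|x - y|)`, with values in `[0,∞]`, of a set `S` of points. -/
noncomputable def potentialField {d : ℕ} (l : ℝ → ℝ) (S : Set (EucSpace d)) (y : EucSpace d) :
    ℝ≥0∞ :=
  ∑' x : S, attenuationExt l ‖(x : EucSpace d) - y‖

/-!
The field is continuous because, locally uniformly in `y`, all but finitely many points contribute a
summable amount. Group the points by the shells `{k ≤ ‖x‖ < k + 1}`. For `‖y‖ < R` and `k ≥ R + 2`, a
point of the `k`-th shell contributes at most `l(k - R)` to `Ψ(y)`. The expected number of points in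
that shell is its volume, of order `k ^ (d - 1)`, and `∑ k ^ (d - 1) * l(k - R)` is finite by
comparison with `∫ r ^ (d - 1) * l(r)`. So the dominating sum over the points of the process has finite
expectation and is almost surely finite, for all `R ∈ ℕ` simultaneously
(`tsum_volume_shell_mul_shellWeight_lt_top`, `IsPoissonProcess.ae_tsum_floor_norm_lt_top`). Giving
weight `1` to the inner shells makes the same event imply local finiteness.

On that event the rest is deterministic (`continuousAt_potentialField_and_eq_top_iff`). On the ball of
radius `R`, the outer points give a finite sum, continuous by dominated convergence, and the finitely
many inner points each give a continuous `[0,∞]`-valued function, infinite exactly at the point itself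
when `l(0) = ∞`.
-/

/-! ### First moments of Poisson counts -/

lemma lintegral_natCast_poissonMeasure (r : ℝ≥0) :
    ∫⁻ n, (n : ℝ≥0∞) ∂poissonMeasure r = r := by
  have hterm : ∀ n : ℕ, ENNReal.ofReal (Real.exp (-r) * r ^ (n + 1) / ((n + 1).factorial)) *
      ((n + 1 : ℕ) : ℝ≥0∞) =
      r * ENNReal.ofReal (Real.exp (-r) * r ^ n / (n.factorial)) := by
    intro n
    rw [← ENNReal.ofReal_natCast, ← ENNReal.ofReal_coe_nnreal, ← ENNReal.ofReal_mul (by positivity),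
      ← ENNReal.ofReal_mul (by positivity), Nat.factorial_succ]
    congr 1
    push_cast
    field_simp
    ring
  have hsum := hasSum_one_poissonMeasure r
  rw [poissonMeasure, lintegral_sum_measure]
  simp_rw [lintegral_smul_measure, lintegral_dirac, smul_eq_mul]
  rw [tsum_eq_zero_add' ENNReal.summable]
  simp_rw [hterm]
  rw [ENNReal.tsum_mul_left, ← ENNReal.ofReal_tsum_of_nonneg (fun n => by positivity) hsum.summable,
    hsum.tsum_eq]
  simp

/-- First-moment formula: the expected number of points of a Poisson process in `B` is
`rate * volume B`. -/
lemma IsPoissonProcess.lintegral_encard {Ω : Type*} [MeasurableSpace Ω] {P : Measure Ω} {d : ℕ}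
    {rate : ℝ≥0} {η : Ω → Set (EucSpace d)} (hη : IsPoissonProcess P rate η)
    {B : Set (EucSpace d)} (hB : MeasurableSet B) (hfin : volume B ≠ ∞) :
    ∫⁻ ω, ((η ω ∩ B).encard : ℝ≥0∞) ∂P = rate * volume B := by
  have h := (hη.law_count B hB hfin).lintegral_comp
    (f := fun n : ℕ∞ => (n : ℝ≥0∞)) (Measurable.of_discrete.aemeasurable)
  rw [h, lintegral_map Measurable.of_discrete Measurable.of_discrete]
  simp only [ENat.toENNReal_coe]
  rw [lintegral_natCast_poissonMeasure]
  simp [ENNReal.coe_toNNReal hfin]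

/-! ### Shells and weights -/

/-- The spherical shell `{x : k ≤ ‖x‖ < k + 1}` of `ℝ^d`, written as a fibre of `x ↦ ⌊‖x‖⌋₊` so that
sums over a set of points can be grouped by shells. -/
def shell (d k : ℕ) : Set (EucSpace d) := {x | ⌊‖x‖⌋₊ = k}

lemma measurableSet_shell (d k : ℕ) : MeasurableSet (shell d k) :=
  (Nat.measurable_floor.comp measurable_norm) (measurableSet_singleton k)

/-- A sum over points of a function of the integer part of the norm, grouped by shells. Both sides
may be infinite. -/
lemma tsum_floor_norm {d : ℕ} (S : Set (EucSpace d)) (h : ℕ → ℝ≥0∞) :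
    ∑' x : S, h ⌊‖(x : EucSpace d)‖⌋₊ = ∑' k, ((S ∩ shell d k).encard : ℝ≥0∞) * h k := by
  rw [← ENNReal.tsum_fiberwise _ (fun x : S => ⌊‖(x : EucSpace d)‖⌋₊)]
  congr 1 with k
  have hc : ∀ x : ((fun x : S => ⌊‖(x : EucSpace d)‖⌋₊) ⁻¹' {k}),
      h ⌊‖((x : S) : EucSpace d)‖⌋₊ = h k := fun x => congrArg h x.2
  rw [tsum_congr hc, ENNReal.tsum_const]
  congr 2
  rw [ENat.card_coe_set_eq, ← Subtype.val_injective.encard_image]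
  congr 1
  ext x
  simp [shell, and_comm]

/-- The volume of a shell grows like `k ^ (d - 1)`, because
`(k + 1) ^ d - k ^ d ≤ d * (k + 1) ^ (d - 1)`. -/
lemma volume_shell_le {d : ℕ} (hd : 1 ≤ d) (k : ℕ) :
    volume (shell d k) ≤
      ENNReal.ofReal (d * ((k : ℝ) + 1) ^ (d - 1)) * volume (Metric.ball (0 : EucSpace d) 1) := by
  have : Nonempty (Fin d) := ⟨⟨0, hd⟩⟩
  have hsub : shell d k ⊆ Metric.ball 0 (k + 1) \ Metric.ball 0 k := by
    intro x (hx : ⌊‖x‖⌋₊ = k)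
    have h1 := Nat.floor_le (norm_nonneg x)
    have h2 := Nat.lt_floor_add_one ‖x‖
    rw [hx] at h1 h2
    simp only [Set.mem_sdiff, mem_ball_zero_iff, not_lt]
    exact ⟨h2, h1⟩
  refine (measure_mono hsub).trans ?_
  rw [measure_sdiff (Metric.ball_subset_ball (by linarith))
    measurableSet_ball.nullMeasurableSet measure_ball_lt_top.ne,
    Measure.addHaar_ball volume (0 : EucSpace d) (by positivity : (0 : ℝ) ≤ k + 1),
    Measure.addHaar_ball volume (0 : EucSpace d) (by positivity : (0 : ℝ) ≤ k),
    ← ENNReal.sub_mul (fun _ _ => measure_ball_lt_top.ne), ← ENNReal.ofReal_sub _ (by positivity)]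
  gcongr
  simp only [finrank_euclideanSpace, Fintype.card_fin]
  have := abs_pow_sub_pow_le ((k : ℝ) + 1) k d
  have h1 := (le_abs_self _).trans this
  have h2 : max |(k : ℝ) + 1| |(k : ℝ)| = k + 1 := by
    rw [abs_of_nonneg (by positivity), abs_of_nonneg (by positivity), max_eq_left (by linarith)]
  rw [h2] at h1
  simpa using h1

/-- A weight on the `k`-th shell which, for `k ≥ R + 2`, bounds the contribution to the field at any
point of the ball of radius `R` from a point of that shell: the two points are at distance more than
`k - R`. For `k < R + 2` the weight is `1`, so that summability of the weights over a set of points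
also forces the set to have finitely many points in these inner shells. -/
noncomputable def shellWeight (l : ℝ → ℝ) (R k : ℕ) : ℝ≥0∞ :=
  if k < R + 2 then 1 else ENNReal.ofReal (l ((k : ℝ) - R))

/-- Comparison of the series of `(j + R + 3) ^ m * l (j + 2)` with `∫ r ^ m * l r` over `(1, ∞)`. -/
lemma tsum_pow_mul_ofReal_lt_top {l : ℝ → ℝ} (hl : IsAttenuation l) {m : ℕ}
    (hint : IntegrableOn (fun r : ℝ => r ^ m * l r) (Set.Ioi 1)) (R : ℕ) :
    ∑' j : ℕ, ENNReal.ofReal (((j : ℝ) + R + 3) ^ m * l (j + 2)) < ∞ := by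
  have hterm : ∀ j : ℕ, ENNReal.ofReal (((j : ℝ) + R + 3) ^ m * l (j + 2)) ≤
      ENNReal.ofReal (((R : ℝ) + 3) ^ m) *
        ∫⁻ r in Set.Ioc ((j : ℝ) + 1) (j + 2), ENNReal.ofReal (r ^ m * l r) := by
    intro j
    calc ENNReal.ofReal (((j : ℝ) + R + 3) ^ m * l (j + 2))
        = ∫⁻ r in Set.Ioc ((j : ℝ) + 1) (j + 2),
            ENNReal.ofReal (((j : ℝ) + R + 3) ^ m * l (j + 2)) := by
          rw [setLIntegral_const, Real.volume_Ioc]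
          norm_num
      _ ≤ ∫⁻ r in Set.Ioc ((j : ℝ) + 1) (j + 2),
            ENNReal.ofReal (((R : ℝ) + 3) ^ m) * ENNReal.ofReal (r ^ m * l r) := by
          refine setLIntegral_mono' measurableSet_Ioc fun r hr => ?_
          have hj : (0 : ℝ) ≤ j := by positivity
          have hR : (0 : ℝ) ≤ R := by positivity
          have hr0 : 0 < r := by linarith [hr.1]
          rw [← ENNReal.ofReal_mul (by positivity), ← mul_assoc, ← mul_pow]
          -- On `(j + 1, j + 2]` one has `r ≥ 1`, hence `j + R + 3 ≤ r + (R + 2) ≤ (R + 3) * r`.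
          have hb : (j : ℝ) + R + 3 ≤ (R + 3) * r := by nlinarith [hr.1]
          have hlr : l (j + 2) ≤ l r := hl.antitone hr0 (by simp; linarith) hr.2
          have h0 := hl.nonneg ((j : ℝ) + 2) (by positivity)
          gcongr
      _ = _ := lintegral_const_mul' _ _ ENNReal.ofReal_ne_top
  have hdisj : Pairwise (Function.onFun Disjoint fun j : ℕ => Set.Ioc ((j : ℝ) + 1) (j + 2)) := by
    have h := Monotone.pairwise_disjoint_on_Ioc_succ (f := fun j : ℕ => (j : ℝ) + 1)
      (fun a b hab => by simpa using hab)
    convert h using 4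
    simp only [Nat.succ_eq_succ, Nat.succ_eq_add_one, Nat.cast_add, Nat.cast_one]
    ring
  calc _ ≤ ∑' j : ℕ, ENNReal.ofReal (((R : ℝ) + 3) ^ m) *
        ∫⁻ r in Set.Ioc ((j : ℝ) + 1) (j + 2), ENNReal.ofReal (r ^ m * l r) :=
        ENNReal.tsum_le_tsum hterm
    _ = ENNReal.ofReal (((R : ℝ) + 3) ^ m) *
        ∫⁻ r in ⋃ j : ℕ, Set.Ioc ((j : ℝ) + 1) (j + 2), ENNReal.ofReal (r ^ m * l r) := by
        rw [ENNReal.tsum_mul_left, lintegral_iUnion (fun _ => measurableSet_Ioc) hdisj]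
    _ ≤ ENNReal.ofReal (((R : ℝ) + 3) ^ m) *
        ∫⁻ r in Set.Ioi 1, ENNReal.ofReal (r ^ m * l r) := by
        gcongr
        refine Set.iUnion_subset fun j r hr => ?_
        have hj : (0 : ℝ) ≤ j := by positivity
        exact lt_of_le_of_lt (by linarith) hr.1
    _ < ∞ := ENNReal.mul_lt_top ENNReal.ofReal_lt_top
        (lt_of_le_of_lt (lintegral_ofReal_le_lintegral_enorm _) hint.2)

lemma tsum_volume_shell_mul_shellWeight_lt_top {d : ℕ} (hd : 1 ≤ d) {l : ℝ → ℝ}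
    (hl : IsAttenuation l)
    (hint : IntegrableOn (fun r : ℝ => r ^ (d - 1) * l r) (Set.Ioi 1)) (R : ℕ) :
    ∑' k, volume (shell d k) * shellWeight l R k < ∞ := by
  have hV : volume (Metric.ball (0 : EucSpace d) 1) < ∞ := measure_ball_lt_top
  have hfin : ∀ k, volume (shell d k) < ∞ := fun k => (volume_shell_le hd k).trans_lt
    (ENNReal.mul_lt_top ENNReal.ofReal_lt_top hV)
  rw [← Summable.sum_add_tsum_nat_add' (k := R + 2) ENNReal.summable]
  refine ENNReal.add_lt_top.2 ⟨ENNReal.sum_lt_top.2 fun k hk => ?_, ?_⟩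
  · rw [shellWeight, if_pos (Finset.mem_range.1 hk), mul_one]
    exact hfin k
  · have hle : ∀ j : ℕ, volume (shell d (j + (R + 2))) * shellWeight l R (j + (R + 2)) ≤
        ENNReal.ofReal d * volume (Metric.ball (0 : EucSpace d) 1) *
          ENNReal.ofReal (((j : ℝ) + R + 3) ^ (d - 1) * l (j + 2)) := by
      intro j
      rw [shellWeight, if_neg (by omega)]
      refine (mul_le_mul_left (volume_shell_le hd _) _).trans_eq ?_
      have h1 : ((j + (R + 2) : ℕ) : ℝ) + 1 = j + R + 3 := by push_cast; ring
      have h2 : ((j + (R + 2) : ℕ) : ℝ) - R = j + 2 := by push_cast; ring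
      rw [h1, h2, ENNReal.ofReal_mul (by positivity), ENNReal.ofReal_mul (by positivity)]
      ring
    refine (ENNReal.tsum_le_tsum hle).trans_lt ?_
    rw [ENNReal.tsum_mul_left]
    exact ENNReal.mul_lt_top (ENNReal.mul_lt_top ENNReal.ofReal_lt_top hV)
      (tsum_pow_mul_ofReal_lt_top hl hint R)

/-! ### Almost sure summability of the weights -/

/-- If the expectation `rate * ∑ k, volume (shell d k) * h k` of the sum of `h ⌊‖x‖⌋₊` over the points
of the process is finite, then the sum is almost surely finite. -/
lemma IsPoissonProcess.ae_tsum_floor_norm_lt_top {Ω : Type*} [MeasurableSpace Ω] {P : Measure Ω}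
    {d : ℕ} {rate : ℝ≥0} {η : Ω → Set (EucSpace d)} (hη : IsPoissonProcess P rate η)
    {h : ℕ → ℝ≥0∞} (hh : ∑' k, volume (shell d k) * h k < ∞) :
    ∀ᵐ ω ∂P, ∑' x : η ω, h ⌊‖(x : EucSpace d)‖⌋₊ < ∞ := by
  have hmeas : ∀ k, Measurable fun ω => ((η ω ∩ shell d k).encard : ℝ≥0∞) := fun k =>
    (Measurable.of_discrete (f := fun n : ℕ∞ => (n : ℝ≥0∞))).comp
      (hη.measurable_count _ (measurableSet_shell d k))
  have hvol : ∀ k, volume (shell d k) ≠ ∞ := fun k => by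
    refine ((measure_mono fun x (hx : ⌊‖x‖⌋₊ = k) => ?_).trans_lt
      (measure_ball_lt_top (x := (0 : EucSpace d)) (r := k + 1))).ne
    rw [mem_ball_zero_iff, ← hx]
    exact Nat.lt_floor_add_one _
  simp_rw [tsum_floor_norm]
  refine ae_lt_top (Measurable.tsum fun k => (hmeas k).mul_const _) ?_
  rw [lintegral_tsum fun k => ((hmeas k).mul_const _).aemeasurable]
  simp_rw [fun k => lintegral_mul_const (μ := P) (h k) (hmeas k),
    fun k => hη.lintegral_encard (measurableSet_shell d k) (hvol k), mul_assoc]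
  rw [ENNReal.tsum_mul_left]
  exact (ENNReal.mul_lt_top ENNReal.coe_lt_top hh).ne

/-! ### The extended attenuation function -/

lemma attenuationExt_zero (l : ℝ → ℝ) : attenuationExt l 0 = attenuationZero l := if_pos rfl

lemma attenuationExt_of_ne (l : ℝ → ℝ) {r : ℝ} (hr : r ≠ 0) :
    attenuationExt l r = ENNReal.ofReal (l r) := if_neg hr

lemma attenuationExt_eq_top_iff {l : ℝ → ℝ} {r : ℝ} :
    attenuationExt l r = ∞ ↔ r = 0 ∧ attenuationZero l = ∞ := by
  by_cases hr : r = 0 <;> simp [attenuationExt, hr]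

/-- Continuity on the closed half-line, as a map to `[0,∞]`: at `0` it is the definition of `l(0)` as
a limit, also when `l(0) = ∞`. -/
lemma continuousOn_attenuationExt {l : ℝ → ℝ} (hl : IsAttenuation l)
    (hcont : ContinuousOn l (Set.Ioi 0)) : ContinuousOn (attenuationExt l) (Set.Ici 0) := by
  intro r (hr : 0 ≤ r)
  rcases hr.eq_or_lt with rfl | hr
  · rw [← Set.Ioi_insert, continuousWithinAt_insert_self, ContinuousWithinAt, attenuationExt_zero]
    refine (tendsto_attenuationZero hl).congr' ?_
    filter_upwards [self_mem_nhdsWithin] with s hs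
    exact (attenuationExt_of_ne l (ne_of_gt hs)).symm
  · refine ContinuousAt.continuousWithinAt ?_
    have h : ContinuousAt (fun s => ENNReal.ofReal (l s)) r :=
      ENNReal.continuous_ofReal.continuousAt.comp (hcont.continuousAt (Ioi_mem_nhds hr))
    refine h.congr ?_
    filter_upwards [Ioi_mem_nhds hr] with s hs
    exact (attenuationExt_of_ne l (ne_of_gt hs)).symm

lemma continuous_attenuationExt_norm_sub {d : ℕ} {l : ℝ → ℝ} (hl : IsAttenuation l)
    (hcont : ContinuousOn l (Set.Ioi 0)) (x : EucSpace d) :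
    Continuous fun y => attenuationExt l ‖x - y‖ :=
  (continuousOn_attenuationExt hl hcont).comp_continuous (by fun_prop) fun _ => norm_nonneg _

lemma attenuationExt_norm_sub_le_shellWeight {d : ℕ} {l : ℝ → ℝ} (hl : IsAttenuation l)
    {R : ℕ} {x y : EucSpace d} (hx : R + 2 ≤ ⌊‖x‖⌋₊) (hy : ‖y‖ < R) :
    attenuationExt l ‖x - y‖ ≤ shellWeight l R ⌊‖x‖⌋₊ := by
  have h1 : (⌊‖x‖⌋₊ : ℝ) ≤ ‖x‖ := Nat.floor_le (norm_nonneg x)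
  have h2 : (R : ℝ) + 2 ≤ ⌊‖x‖⌋₊ := by exact_mod_cast hx
  have h3 := norm_sub_norm_le x y
  have h4 : 0 < ‖x - y‖ := by linarith
  rw [attenuationExt_of_ne l h4.ne', shellWeight, if_neg (by omega)]
  refine ENNReal.ofReal_le_ofReal (hl.antitone ?_ h4 ?_)
  · simp only [Set.mem_Ioi]; linarith
  · linarith

/-! ### Continuity of the field of a point set -/

/-- Dominated convergence for sums in `[0,∞]`: a sum of functions continuous at `y` that are bounded
near `y` by a family with finite sum is continuous at `y`. -/
lemma ENNReal.continuousAt_tsum_of_dominated {ι X : Type*} [TopologicalSpace X]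
    [FirstCountableTopology X] {f : ι → X → ℝ≥0∞} {u : ι → ℝ≥0∞} {y : X}
    (hf : ∀ i, ContinuousAt (f i) y) (hu : ∑' i, u i ≠ ∞) (hle : ∀ᶠ z in 𝓝 y, ∀ i, f i z ≤ u i) :
    ContinuousAt (fun z => ∑' i, f i z) y := by
  let _ : MeasurableSpace ι := ⊤
  simp only [ContinuousAt, ← lintegral_count]
  refine tendsto_lintegral_filter_of_dominated_convergence u
    (Eventually.of_forall fun _ => Measurable.of_discrete)
    (hle.mono fun z hz => Eventually.of_forall hz) ?_ (Eventually.of_forall hf)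
  rwa [lintegral_count]

section Deterministic

variable {d : ℕ} {l : ℝ → ℝ} {S : Set (EucSpace d)}

/-- The points of `S` in the inner shells have weight `1`, hence there are finitely many of them. -/
lemma finite_setOf_floor_norm_lt {R : ℕ}
    (hS : ∑' x : S, shellWeight l R ⌊‖(x : EucSpace d)‖⌋₊ < ∞) :
    {x : S | ⌊‖(x : EucSpace d)‖⌋₊ < R + 2}.Finite := by
  refine (ENNReal.finite_const_le_of_tsum_ne_top hS.ne one_ne_zero).subset fun x hx => ?_
  have hx' : ⌊‖(x : EucSpace d)‖⌋₊ < R + 2 := hx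
  simp [shellWeight, hx']

/-- The deterministic part of the argument. On the ball of radius `R` the field is a finite sum over the
points of the inner shells plus a sum dominated by the weights; the latter is finite and continuous,
so the field can be infinite only through a single term of the finite sum. -/
lemma continuousAt_potentialField_and_eq_top_iff (hl : IsAttenuation l)
    (hcont : ContinuousOn l (Set.Ioi 0)) {R : ℕ}
    (hS : ∑' x : S, shellWeight l R ⌊‖(x : EucSpace d)‖⌋₊ < ∞) {y : EucSpace d} (hy : ‖y‖ < R) :
    ContinuousAt (potentialField l S) y ∧
      (potentialField l S y = ∞ ↔ attenuationZero l = ∞ ∧ y ∈ S) := by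
  set F : Set S := {x : S | ⌊‖(x : EucSpace d)‖⌋₊ < R + 2} with hF
  have : Fintype F := (finite_setOf_floor_norm_lt hS).fintype
  have hsplit : potentialField l S = fun z =>
      ∑ x : F, attenuationExt l ‖((x : S) : EucSpace d) - z‖ +
        ∑' x : (Fᶜ : Set S), attenuationExt l ‖((x : S) : EucSpace d) - z‖ := by
    ext z
    rw [← tsum_fintype (L := .unconditional _)]
    exact (ENNReal.summable.tsum_add_tsum_compl (s := F) ENNReal.summable).symm
  have hle : ∀ z : EucSpace d, ‖z‖ < R → ∀ x : (Fᶜ : Set S),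
      attenuationExt l ‖((x : S) : EucSpace d) - z‖ ≤
        shellWeight l R ⌊‖((x : S) : EucSpace d)‖⌋₊ := fun z hz x =>
    attenuationExt_norm_sub_le_shellWeight hl (not_lt.1 x.2) hz
  have htail : ∑' x : (Fᶜ : Set S), shellWeight l R ⌊‖((x : S) : EucSpace d)‖⌋₊ ≠ ∞ :=
    ((ENNReal.tsum_comp_le_tsum_of_injective Subtype.val_injective
      (fun x : S => shellWeight l R ⌊‖(x : EucSpace d)‖⌋₊)).trans_lt hS).ne
  have hev : ∀ᶠ z in 𝓝 y, ‖z‖ < R := continuous_norm.continuousAt.eventually_lt_const hy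
  constructor
  · rw [hsplit]
    refine ContinuousAt.add ?_ ?_
    · exact (continuous_finsetSum _ fun x _ =>
        continuous_attenuationExt_norm_sub hl hcont _).continuousAt
    · exact ENNReal.continuousAt_tsum_of_dominated
        (fun x => (continuous_attenuationExt_norm_sub hl hcont _).continuousAt) htail
        (hev.mono hle)
  · constructor
    · intro h
      have hfin : ∑' x : (Fᶜ : Set S), attenuationExt l ‖((x : S) : EucSpace d) - y‖ ≠ ∞ :=
        ((ENNReal.tsum_le_tsum (hle y hy)).trans_lt htail.lt_top).ne
      rw [hsplit, ENNReal.add_eq_top, or_iff_left hfin, ENNReal.sum_eq_top] at h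
      obtain ⟨x, -, hx⟩ := h
      obtain ⟨h0, htop⟩ := attenuationExt_eq_top_iff.1 hx
      exact ⟨htop, sub_eq_zero.1 (norm_eq_zero.1 h0) ▸ (x : S).2⟩
    · rintro ⟨htop, hyS⟩
      refine top_unique (le_trans ?_ (ENNReal.le_tsum (⟨y, hyS⟩ : S)))
      simp [attenuationExt_zero, htop]

end Deterministic

theorem proposition1p4 {Ω : Type*} [MeasurableSpace Ω] (P : Measure Ω) [IsProbabilityMeasure P]
    (d : ℕ) (hd : 1 ≤ d) (η : Ω → Set (EucSpace d)) (hη : IsPoissonProcess P 1 η)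
    (l : ℝ → ℝ) (hl : IsAttenuation l)
    (hint : IntegrableOn (fun r : ℝ => r ^ (d - 1) * l r) (Set.Ioi 1))
    (hcont : ContinuousOn l (Set.Ioi 0)) :
    ∀ᵐ ω ∂P, Continuous (potentialField l (η ω)) ∧
      ∀ y : EucSpace d, potentialField l (η ω) y = ∞ ↔ (attenuationZero l = ∞ ∧ y ∈ η ω) := by
  have hae : ∀ᵐ ω ∂P, ∀ R : ℕ,
      ∑' x : η ω, shellWeight l R ⌊‖(x : EucSpace d)‖⌋₊ < ∞ := ae_all_iff.2 fun R =>
    hη.ae_tsum_floor_norm_lt_top (tsum_volume_shell_mul_shellWeight_lt_top hd hl hint R)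
  filter_upwards [hae] with ω hω
  have key := fun y : EucSpace d =>
    continuousAt_potentialField_and_eq_top_iff hl hcont (hω (⌊‖y‖⌋₊ + 1)) (y := y)
      (by exact_mod_cast Nat.lt_floor_add_one ‖y‖)
  exact ⟨continuous_iff_continuousAt.2 fun y => (key y).1, fun y => (key y).2⟩
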